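/- Let $G$ be a locally compact second countable group (that is, a Polish group whose topology is locally compact), with identity $e$, and let $X$ be a free Borel $G$-space: a standard Borel space with an action of $G$ such that $(g,x)\mapsto g.x$ is Borel and $g.x\neq x$ whenever $g\neq e$. Let $E_G^X=\{(x,g.x):x\in X,\ g\in G\}$ be its orbit equivalence relation. *Definitions.* An OER on $X$ is an equivalence relation $E\subset E_G^X$ that is a Borel subset of $X\times X$; for $x\in X$ put $G_E(x)=\{g\in G:(x,g.x)\in E\}$. The OER $E$ is *compact* if there is a compact identity neighbourhood $K\subset G$ with $G_E(x)\subset K$ for every $x\in X$. A *compact filtration* of $E_G^X$ is an increasing sequence $E_0\subset E_1\subset\dotsm$ of compact OERs with $E_G^X=\bigcup_n E_n$; it is *equicompact* if for every $x\in X$ and every compact set $C\subset G$ one has $C\subset G_{E_n}(x)$ for all sufficiently large $n$. $E_G^X$ is *hypercompact* if it admits an equicompact filtration. A *lacunary cocompact cross section* is a Borel set $\mathfrak C\subset X$ that meets every orbit in at most countably many points, such that for some symmetric identity neighbourhood $U\subset G$ the action map $U\times\mathfrak C\to X$ is injective, and for some compact identity neighbourhood $K\subset G$ one has $K.\mathfrak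 C=X$. An equivalence relation on a standard Borel space is *hyperfinite* if it is the union of an increasing sequence of Borel equivalence relations all of whose classes are finite. $E_G^X$ is *sectional-hyperfinite* if $E_G^X\cap(\mathfrak C\times\mathfrak C)$ is hyperfinite for every lacunary cocompact cross section $\mathfrak C$. **Theorem.** The following are equivalent: 1. $E_G^X$ admits a compact filtration. 2. $E_G^X$ is sectional-hyperfinite. 3. $E_G^X$ is hypercompact. 4. There exists a lacunary cocompact cross section $\mathfrak C$ of $X$ such that $E_G^X\cap(\mathfrak C\times\mathfrak C)$ is hyperfinite. -/

import Mathlib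

open scoped Pointwise Topology

section Hyperfinite

/-- An equivalence relation on a Borel space is Borel if its graph is a Borel subset of the
square. -/
def IsBorelEquiv {Y : Type*} [MeasurableSpace Y] (r : Setoid Y) : Prop :=
  MeasurableSet {p : Y × Y | r p.1 p.2}

/-- A finite filtration of `r`: an increasing sequence of Borel equivalence relations, all of
whose classes are finite, with union `r`. -/
structure IsFiniteFiltration {Y : Type*} [MeasurableSpace Y] (r : Setoid Y)
    (F : ℕ → Setoid Y) : Prop where
  borel : ∀ n, IsBorelEquiv (F n)
  finite : ∀ n y, {z : Y | F n y z}.Finite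
  mono : Monotone F
  union : ∀ y z, r y z ↔ ∃ n, F n y z

/-- Hyperfiniteness. (Such an `r` automatically has countable classes and is Borel.) -/
def IsHyperfinite {Y : Type*} [MeasurableSpace Y] (r : Setoid Y) : Prop :=
  ∃ F : ℕ → Setoid Y, IsFiniteFiltration r F

end Hyperfinite

section CrossSection

/-- A cross section: a Borel set meeting every orbit in at most countably many points. -/
structure IsCrossSection (G : Type*) {X : Type*} [Group G] [MulAction G X] [MeasurableSpace X]
    (C : Set X) : Prop where
  borel : MeasurableSet C
  countable : ∀ x : X, (C ∩ MulAction.orbit G x).Countable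

/-- `C` is `U`-lacunary for some symmetric identity neighbourhood `U`: the action map
`U × C → X` is injective. -/
def IsLacunary (G : Type*) {X : Type*} [Group G] [TopologicalSpace G] [MulAction G X]
    (C : Set X) : Prop :=
  ∃ U : Set G, U ∈ 𝓝 (1 : G) ∧ U⁻¹ = U ∧ Set.InjOn (fun p : G × X => p.1 • p.2) (U ×ˢ C)

/-- `C` is `K`-cocompact for some compact identity neighbourhood `K`: `K • C = X`. -/
def IsCocompact (G : Type*) {X : Type*} [Group G] [TopologicalSpace G] [MulAction G X]
    (C : Set X) : Prop :=
  ∃ K : Set G, K ∈ 𝓝 (1 : G) ∧ IsCompact K ∧ K • C = Set.univ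

/-- A lacunary cocompact cross section. -/
structure IsLacunaryCocompactCrossSection (G : Type*) {X : Type*} [Group G] [TopologicalSpace G]
    [MulAction G X] [MeasurableSpace X] (C : Set X) : Prop where
  crossSection : IsCrossSection G C
  lacunary : IsLacunary G C
  cocompact : IsCocompact G C

/-- The restriction `E_G^X ∩ (C × C)` of the orbit equivalence relation, as an equivalence
relation on the Borel space `C`. -/
def orbitRelOn (G : Type*) {X : Type*} [Group G] [MulAction G X] (C : Set X) : Setoid C :=
  (MulAction.orbitRel G X).comap Subtype.val

/-- The restriction of the orbit equivalence relation to every lacunary cocompact cross section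
is hyperfinite. -/
def IsSectionalHyperfinite (G X : Type*) [Group G] [TopologicalSpace G] [MulAction G X]
    [MeasurableSpace X] : Prop :=
  ∀ C : Set X, IsLacunaryCocompactCrossSection G C → IsHyperfinite (orbitRelOn G C)

end CrossSection

section Hypercompact

/-- An OER: a Borel subequivalence relation of the orbit equivalence relation. -/
structure IsOER (G : Type*) {X : Type*} [Group G] [MulAction G X] [MeasurableSpace X]
    (E : Setoid X) : Prop where
  borel : IsBorelEquiv E
  le_orbitRel : E ≤ MulAction.orbitRel G X

/-- `G_E(x) = {g ∈ G : (x, g.x) ∈ E}`. -/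
def returnSet (G : Type*) {X : Type*} [Group G] [MulAction G X] (E : Setoid X) (x : X) : Set G :=
  {g : G | E x (g • x)}

/-- A compact OER: the sets `G_E(x)` all lie in one compact identity neighbourhood. -/
structure IsCompactOER (G : Type*) {X : Type*} [Group G] [TopologicalSpace G] [MulAction G X]
    [MeasurableSpace X] (E : Setoid X) : Prop where
  isOER : IsOER G E
  compact : ∃ K : Set G, K ∈ 𝓝 (1 : G) ∧ IsCompact K ∧ ∀ x : X, returnSet G E x ⊆ K

/-- A compact filtration of `E_G^X`: an increasing sequence of compact OERs with union `E_G^X`. -/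
structure IsCompactFiltration (G : Type*) {X : Type*} [Group G] [TopologicalSpace G]
    [MulAction G X] [MeasurableSpace X] (E : ℕ → Setoid X) : Prop where
  compactOER : ∀ n, IsCompactOER G (E n)
  mono : Monotone E
  union : ∀ x y, MulAction.orbitRel G X x y ↔ ∃ n, E n x y

/-- An equicompact filtration of `E_G^X`: a compact filtration such that for every `x`, every
compact subset of `G` is contained in `G_{E_n}(x)` for all sufficiently large `n`. The sets
`G_{E_n}(x)` are relatively compact, and need not be closed. -/
structure IsEquicompactFiltration (G : Type*) {X : Type*} [Group G] [TopologicalSpace G]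
    [MulAction G X] [MeasurableSpace X] (E : ℕ → Setoid X) : Prop where
  compactFiltration : IsCompactFiltration G E
  equicompact : ∀ (x : X) (C : Set G), IsCompact C →
    ∀ᶠ n in Filter.atTop, C ⊆ returnSet G (E n) x

/-- `E_G^X` is hypercompact if it admits an equicompact filtration. -/
def IsHypercompact (G X : Type*) [Group G] [TopologicalSpace G] [MulAction G X]
    [MeasurableSpace X] : Prop :=
  ∃ E : ℕ → Setoid X, IsEquicompactFiltration G E

end Hypercompact

/-! Freeness identifies each orbit with `G`, and lacunarity of `C` makes the return elements `{g | g
• x ∈ C}` uniformly separated, hence finite on compact sets. This is the bridge between "finite" on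
`C` and "compact" on `X`. A compact filtration restricted to `C` therefore has finite classes, which
gives 1 → 2.

For 4 → 3, a Borel map `π` sends every point to a point of `C` at distance bounded by a compact set,
and a finite filtration of `C` is pulled back along `π`. Finite classes need not be uniformly
bounded in `G`, so at stage `n` only classes bounded by the `n`-th set of a compact exhaustion are
kept, from all relations up to index `n` (`boundedPart`). Every finite class is eventually kept, and
a compact set of translates of `x` meets only finitely many values of `π`, so the filtration is
equicompact. The step 3 → 1 is immediate.

The step 2 → 4 needs a lacunary cocompact cross section to exist. Haar averages of indicators along
orbits give countably many orbit-continuous Borel functions separating points of each orbit. They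
cut `X` into countably many Borel pieces on which returns by `K * K` already lie in `K`; a
lexicographic minimum then selects sparse sets, and a greedy union combines these into a maximal
sparse set, which is cocompact.

Borel measurability throughout comes from two kinds of projection along `G`: separated sections
(injective images), and closed conditions over a compact set (countable dense subsets). -/

set_option linter.unusedSectionVars false

/-! ### Uniformly separated subsets of a group -/

section Separated

variable {G : Type*} [Group G]

/-- A subset of a group is `V`-separated if distinct elements `g`, `h` satisfy `h * g⁻¹ ∉ V`. -/
def SeparatedBy (V S : Set G) : Prop :=
  ∀ g ∈ S, ∀ h ∈ S, h * g⁻¹ ∈ V → g = h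

theorem SeparatedBy.mono {V S T : Set G} (h : SeparatedBy V T) (hST : S ⊆ T) :
    SeparatedBy V S :=
  fun g hg k hk hgk => h g (hST hg) k (hST hk) hgk

variable [TopologicalSpace G] [IsTopologicalGroup G]

theorem exists_isOpen_div_mem {V : Set G} (hV : V ∈ 𝓝 (1 : G)) :
    ∃ W : Set G, IsOpen W ∧ (1 : G) ∈ W ∧ ∀ a ∈ W, ∀ b ∈ W, a * b⁻¹ ∈ V := by
  obtain ⟨W, hW, h⟩ := exists_nhds_split_inv hV
  obtain ⟨O, hO, hOo, h1⟩ := mem_nhds_iff.1 hW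
  exact ⟨O, hOo, h1, fun a ha b hb => by simpa [div_eq_mul_inv] using h a (hO ha) b (hO hb)⟩

theorem exists_seq_mul_inv_mem [TopologicalSpace.SeparableSpace G] {W : Set G}
    (hW : IsOpen W) (h1 : (1 : G) ∈ W) (g : G) :
    ∃ i, g * (TopologicalSpace.denseSeq G i)⁻¹ ∈ W := by
  have ho : IsOpen {d : G | g * d⁻¹ ∈ W} := hW.preimage (by fun_prop)
  obtain ⟨_, hd, i, rfl⟩ := (TopologicalSpace.denseRange_denseSeq G).inter_open_nonempty _ ho
    ⟨g, by simpa using h1⟩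
  exact ⟨i, hd⟩

theorem SeparatedBy.countable [TopologicalSpace.SeparableSpace G] {V S : Set G}
    (hV : V ∈ 𝓝 (1 : G)) (h : SeparatedBy V S) : S.Countable := by
  obtain ⟨W, hW, h1, hWV⟩ := exists_isOpen_div_mem hV
  choose i hi using exists_seq_mul_inv_mem hW h1
  refine Set.MapsTo.countable_of_injOn (f := i) (t := Set.univ) (fun _ _ => trivial) ?_
    Set.countable_univ
  intro g hg k hk hgk
  refine h g hg k hk ?_
  have := hWV _ (hi k) _ (hgk ▸ hi g)
  rwa [show k * (TopologicalSpace.denseSeq G (i k))⁻¹ *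
    (g * (TopologicalSpace.denseSeq G (i k))⁻¹)⁻¹ = k * g⁻¹ by group] at this

/-- Finitely many small right translates cover `K`, and each contains at most one point of `S`. -/
theorem SeparatedBy.finite_inter {V S K : Set G}
    (hV : V ∈ 𝓝 (1 : G)) (h : SeparatedBy V S) (hK : IsCompact K) : (S ∩ K).Finite := by
  obtain ⟨W, hW, h1, hWV⟩ := exists_isOpen_div_mem hV
  obtain ⟨t, -, ht⟩ := hK.elim_nhds_subcover (fun d => {g | g * d⁻¹ ∈ W}) (fun d _ =>
    (hW.preimage (by fun_prop : Continuous fun g : G => g * d⁻¹)).mem_nhds (by simpa using h1))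
  have : ∀ g : (S ∩ K : Set G), ∃ d : t, (g : G) * (d : G)⁻¹ ∈ W := fun g => by
    simpa using ht g.2.2
  choose i hi using this
  have : Finite (S ∩ K : Set G) := by
    refine Finite.of_injective i fun g k hgk => Subtype.ext (h g g.2.1 k k.2.1 ?_)
    have := hWV _ (hi k) _ (hgk ▸ hi g)
    rwa [show (k : G) * (i k : G)⁻¹ * (g * (i k : G)⁻¹)⁻¹ = k * (g : G)⁻¹ by group] at this
  exact Set.toFinite _

end Separated

/-! ### Borel projections with separated sections -/

section Projection

variable {G : Type*} [Group G] [TopologicalSpace G] [IsTopologicalGroup G] [PolishSpace G]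
  [MeasurableSpace G] [BorelSpace G]

/-- Projections of Borel sets with uniformly separated sections are Borel. -/
theorem measurableSet_exists_of_separatedBy {Z : Type*} [MeasurableSpace Z]
    [StandardBorelSpace Z] {V : Set G} (hV : V ∈ 𝓝 (1 : G)) {P : G → Z → Prop}
    (hP : MeasurableSet {p : G × Z | P p.1 p.2})
    (hsep : ∀ z, SeparatedBy V {g | P g z}) : MeasurableSet {z | ∃ g, P g z} := by
  obtain ⟨W, hW, h1, hWV⟩ := exists_isOpen_div_mem hV
  have key : {z | ∃ g, P g z} = ⋃ i, Prod.snd '' ({p : G × Z | P p.1 p.2} ∩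
      {p | p.1 * (TopologicalSpace.denseSeq G i)⁻¹ ∈ W}) := by
    ext z
    simp only [Set.mem_ofPred_eq, Set.mem_iUnion, Set.mem_image, Set.mem_inter_iff, Prod.exists,
      exists_eq_right]
    constructor
    · rintro ⟨g, hg⟩
      obtain ⟨i, hi⟩ := exists_seq_mul_inv_mem hW h1 g
      exact ⟨i, g, hg, hi⟩
    · rintro ⟨i, g, hg, -⟩
      exact ⟨g, hg⟩
  rw [key]
  -- Over one translate of `W` each section has at most one point, so the projection is injective
  -- there and the Lusin–Souslin theorem applies.
  refine MeasurableSet.iUnion fun i => MeasurableSet.image_of_measurable_injOn ?_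
    measurable_snd ?_
  · refine hP.inter ?_
    exact (hW.preimage (by fun_prop : Continuous
      fun g : G => g * (TopologicalSpace.denseSeq G i)⁻¹)).measurableSet.preimage measurable_fst
  · rintro ⟨g, z⟩ ⟨hg, hgW⟩ ⟨h, z'⟩ ⟨hh, hhW⟩ (rfl : z = z')
    have := hWV _ hhW _ hgW
    simp only [mul_inv_rev, inv_inv, inv_mul_cancel_left, mul_assoc] at this
    rw [hsep z g hg h hh this]

end Projection

/-! ### Sparse sets and lacunarity -/

section SparseSets

variable {G : Type*} [Group G] {X : Type*} [MulAction G X]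

/-- Freeness: two elements of the group moving a point to the same place agree. -/
def IsFreeAction (G X : Type*) [Group G] [MulAction G X] : Prop :=
  ∀ (x : X) (g h : G), g • x = h • x → g = h

theorem isFreeAction_of_smul_ne (hfree : ∀ g : G, g ≠ 1 → ∀ x : X, g • x ≠ x) :
    IsFreeAction G X := by
  intro x g h hgh
  by_contra hne
  refine hfree (h⁻¹ * g) (fun h1 => hne (inv_mul_eq_one.1 h1).symm) x ?_
  rw [mul_smul, hgh, inv_smul_smul]

/-- No point of `C` is moved to another point of `C` by an element of `V`. -/
def IsSparse (V : Set G) (C : Set X) : Prop :=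
  ∀ x ∈ C, ∀ g ∈ V, g • x ∈ C → g • x = x

theorem IsSparse.separatedBy {V : Set G} {C : Set X} (hC : IsSparse V C)
    (hf : IsFreeAction G X) (x : X) : SeparatedBy V {g : G | g • x ∈ C} := by
  intro g hg h hh hgh
  have := hC (g • x) hg _ hgh (by simpa [mul_smul] using hh)
  rw [smul_smul, inv_mul_cancel_right] at this
  exact hf x _ _ this.symm

theorem IsLacunary.exists_isSparse [TopologicalSpace G] {C : Set X} (hC : IsLacunary G C) :
    ∃ V ∈ 𝓝 (1 : G), IsSparse V C := by
  obtain ⟨U, hU, -, hinj⟩ := hC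
  refine ⟨U, hU, fun x hx g hg hgx => ?_⟩
  have := @hinj (g, x) ⟨hg, hx⟩ (1, g • x) ⟨mem_of_mem_nhds hU, hgx⟩ (by simp)
  exact (Prod.mk.inj this).2.symm

theorem IsSparse.isLacunary [TopologicalSpace G] {K : Set G} {C : Set X} (hK : K ∈ 𝓝 (1 : G))
    (hKs : K⁻¹ = K) (hf : IsFreeAction G X) (hC : IsSparse (K * K) C) : IsLacunary G C := by
  refine ⟨K, hK, hKs, ?_⟩
  rintro ⟨g, x⟩ ⟨hg, hx⟩ ⟨h, y⟩ ⟨hh, hy⟩ (hxy : g • x = h • y)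
  simp only at hg hx hh hy
  have hy' : y = (h⁻¹ * g) • x := by rw [mul_smul, hxy, inv_smul_smul]
  have : y = x := by
    rw [hy']
    refine hC x hx _ (Set.mul_mem_mul (by rw [← hKs]; simpa using hh) hg) (hy' ▸ hy)
  subst this
  rw [hf _ _ _ hxy]

theorem IsSparse.isCrossSection [TopologicalSpace G] [IsTopologicalGroup G]
    [TopologicalSpace.SeparableSpace G] [MeasurableSpace X] {V : Set G} {C : Set X}
    (hV : V ∈ 𝓝 (1 : G)) (hf : IsFreeAction G X) (hC : IsSparse V C) (hm : MeasurableSet C) :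
    IsCrossSection G C := by
  refine ⟨hm, fun x => ?_⟩
  refine (((hC.separatedBy hf x).countable hV).image (fun g => g • x)).mono ?_
  rintro _ ⟨hy, g, rfl⟩
  exact ⟨g, hy, rfl⟩

end SparseSets

/-! ### From compact filtrations to finite ones -/

section RestrictFiltration

variable {G : Type*} [Group G] [TopologicalSpace G] [IsTopologicalGroup G]
  {X : Type*} [MeasurableSpace X] [MulAction G X]

/-- The class of `c` inside `C` is the image of a separated set of group elements lying in a compact
set, hence finite. -/
theorem IsCompactFiltration.isSectionalHyperfinite {E : ℕ → Setoid X}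
    (hE : IsCompactFiltration G E) (hf : IsFreeAction G X) : IsSectionalHyperfinite G X := by
  intro C hC
  obtain ⟨V, hV, hCV⟩ := hC.lacunary.exists_isSparse
  refine ⟨fun n => (E n).comap Subtype.val, ?_, ?_, ?_, ?_⟩
  · intro n
    exact (hE.compactOER n).isOER.borel.preimage
      (measurable_subtype_coe.prodMap measurable_subtype_coe)
  · intro n c
    obtain ⟨K, -, hK, hEK⟩ := (hE.compactOER n).compact
    have hfin := (hCV.separatedBy hf (c : X)).finite_inter hV hK
    refine Set.Finite.of_finite_image (f := Subtype.val) ?_ Subtype.val_injective.injOn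
    refine (hfin.image (fun g => g • (c : X))).subset ?_
    rintro _ ⟨d, hd, rfl⟩
    have hd' : E n c d := hd
    obtain ⟨g, hg⟩ : (d : X) ∈ MulAction.orbit G (c : X) :=
      (MulAction.orbitRel G X).symm ((hE.compactOER n).isOER.le_orbitRel hd')
    simp only at hg
    refine ⟨g, ⟨by simp [hg], hEK c ?_⟩, hg⟩
    simpa [returnSet, hg] using hd'
  · intro m n hmn c d h
    exact hE.mono hmn h
  · intro c d
    exact hE.union c d

end RestrictFiltration

/-! ### Orbit-continuous separating functions by Haar averaging -/

section OrbitContinuous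

open MeasureTheory

theorem exists_countable_isPiSystem_generateFrom (X : Type*) [m : MeasurableSpace X]
    [MeasurableSpace.CountablyGenerated X] :
    ∃ 𝒜 : Set (Set X), 𝒜.Countable ∧ IsPiSystem 𝒜 ∧ m = MeasurableSpace.generateFrom 𝒜 ∧
      Set.univ ∈ 𝒜 := by
  have halg := isSetAlgebra_generateSetAlgebra (𝒜 := MeasurableSpace.countableGeneratingSet X)
  refine ⟨generateSetAlgebra (MeasurableSpace.countableGeneratingSet X),
    countable_generateSetAlgebra (MeasurableSpace.countable_countableGeneratingSet (α := X)),
    fun s hs t ht _ => halg.inter_mem hs ht, ?_, halg.univ_mem⟩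
  rw [generateFrom_generateSetAlgebra_eq, MeasurableSpace.generateFrom_countableGeneratingSet]

theorem exists_bump_subset {G : Type*} [TopologicalSpace G] [T2Space G]
    [LocallyCompactSpace G] {x : G} {V : Set G} (hV : V ∈ 𝓝 x) :
    ∃ φ : C(G, ℝ), φ x = 1 ∧ HasCompactSupport φ ∧ (∀ g, 0 ≤ φ g) ∧ Function.support φ ⊆ V := by
  obtain ⟨O, hO, hOo, hxO⟩ := mem_nhds_iff.1 hV
  obtain ⟨φ, h1, h0, hc, hI⟩ := exists_continuous_one_zero_of_isCompact
    (isCompact_singleton (x := x)) hOo.isClosed_compl (by simpa using hxO)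
  refine ⟨φ, h1 rfl, hc, fun g => (hI g).1, fun g hg => hO ?_⟩
  by_contra hgO
  exact hg (h0 hgO)

variable {G : Type*} [Group G] [TopologicalSpace G] [IsTopologicalGroup G] [PolishSpace G]
  [LocallyCompactSpace G] [MeasurableSpace G] [BorelSpace G]
  {X : Type*} [MeasurableSpace X] [MulAction G X] [MeasurableSMul₂ G X]

/-- The average of the indicator function of `A` along the orbit of `x`, with weight `φ`. -/
noncomputable def orbitAverage (φ : G → ℝ) (A : Set X) (x : X) : ℝ :=
  ∫ g in {g : G | g⁻¹ • x ∈ A}, φ g ∂(Measure.haar : Measure G)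

theorem measurable_inv_smul_prod : Measurable fun p : G × X => p.1⁻¹ • p.2 :=
  measurable_fst.inv.smul measurable_snd

theorem measurable_inv_smul_const (x : X) : Measurable fun g : G => g⁻¹ • x :=
  measurable_inv_smul_prod.comp measurable_prodMk_right

/-- Left invariance of Haar measure shifts the translation from the Borel set, where nothing is
continuous, to the weight `φ`; the result is a convolution with a continuous compactly supported
function. -/
theorem continuous_orbitAverage_smul {φ : G → ℝ} (hφ : Continuous φ) (hc : HasCompactSupport φ)
    {A : Set X} (hA : MeasurableSet A) (x : X) :
    Continuous fun g : G => orbitAverage φ A (g • x) := by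
  have hB : MeasurableSet {g : G | g⁻¹ • x ∈ A} := measurable_inv_smul_const x hA
  have key : ∀ h : G, orbitAverage φ A (h • x) =
      ∫ g in {g : G | g⁻¹ • x ∈ A}, (φ ∘ Inv.inv) (g⁻¹ * h⁻¹) ∂(Measure.haar : Measure G) := by
    intro h
    rw [orbitAverage, ← integral_indicator
      (show MeasurableSet {g : G | g⁻¹ • h • x ∈ A} from measurable_inv_smul_const (h • x) hA),
      ← integral_indicator hB, ← integral_mul_left_eq_self _ h]
    refine integral_congr_ae (Filter.Eventually.of_forall fun g => ?_)
    have hg : (h * g)⁻¹ • h • x = g⁻¹ • x := by rw [smul_smul]; group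
    simp only [Set.indicator, Set.mem_ofPred_eq, Function.comp, mul_inv_rev, inv_inv]
    congr 1
    exact congrArg (· ∈ A) hg
  simp_rw [key]
  have h2 : HasCompactSupport (φ ∘ Inv.inv : G → ℝ) :=
    hc.comp_homeomorph (Homeomorph.inv G)
  exact (continuous_integral_apply_inv_mul (hφ.comp continuous_inv) h2).comp continuous_inv

theorem orbitAverage_eq_toReal {φ : G → ℝ} (hφ : Continuous φ) (h0 : ∀ g, 0 ≤ φ g)
    {A : Set X} (hA : MeasurableSet A) (x : X) :
    orbitAverage φ A x = ((((Measure.haar : Measure G).withDensity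
      fun g => ENNReal.ofReal (φ g)).map fun g => g⁻¹ • x) A).toReal := by
  rw [Measure.map_apply (measurable_inv_smul_const x) hA,
    withDensity_apply _ (measurable_inv_smul_const x hA), orbitAverage,
    integral_eq_lintegral_of_nonneg_ae (Filter.Eventually.of_forall h0)
      hφ.aestronglyMeasurable]
  rfl

theorem isFiniteMeasure_withDensity_bump {φ : G → ℝ} (hφ : Continuous φ)
    (hc : HasCompactSupport φ) :
    IsFiniteMeasure ((Measure.haar : Measure G).withDensity fun g => ENNReal.ofReal (φ g)) :=
  isFiniteMeasure_withDensity_ofReal (hφ.integrable_of_hasCompactSupport hc).2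

theorem measurable_orbitAverage {φ : G → ℝ} (hφ : Continuous φ) (hc : HasCompactSupport φ)
    (h0 : ∀ g, 0 ≤ φ g) {A : Set X} (hA : MeasurableSet A) :
    Measurable (orbitAverage φ A : X → ℝ) := by
  have := isFiniteMeasure_withDensity_bump hφ hc
  have h : (orbitAverage φ A : X → ℝ) = fun x => (((Measure.haar : Measure G).withDensity
      fun g => ENNReal.ofReal (φ g)) ((fun g => (g, x)) ⁻¹' {p : G × X | p.1⁻¹ • p.2 ∈ A})).toReal := by
    ext x
    rw [orbitAverage_eq_toReal hφ h0 hA, Measure.map_apply (measurable_inv_smul_const x) hA]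
    rfl
  rw [h]
  exact (measurable_measure_prodMk_right (measurable_inv_smul_prod hA)).ennreal_toReal

/-- Equal averages on a generating π-system make the images of the measure `φ dg` around `x` and `h
• x` equal. These are nonzero and carried by images of the support of `φ`, so the two images meet,
and freeness reads off `h`. -/
theorem div_mem_of_orbitAverage_eq [StandardBorelSpace X] (hf : IsFreeAction G X)
    {𝒜 : Set (Set X)} (hpi : IsPiSystem 𝒜)
    (hgen : ‹MeasurableSpace X› = MeasurableSpace.generateFrom 𝒜) (huniv : Set.univ ∈ 𝒜)
    {φ : G → ℝ} (hφ : Continuous φ) (hc : HasCompactSupport φ) (h0 : ∀ g, 0 ≤ φ g)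
    (h1 : φ 1 = 1) {h : G} {x : X}
    (heq : ∀ A ∈ 𝒜, orbitAverage φ A (h • x) = orbitAverage φ A x) :
    ∃ a ∈ Function.support φ, ∃ b ∈ Function.support φ, h = a * b⁻¹ := by
  set ν : Measure G := (Measure.haar : Measure G).withDensity fun g => ENNReal.ofReal (φ g) with hν
  have hfin : IsFiniteMeasure ν := isFiniteMeasure_withDensity_bump hφ hc
  have hm : ∀ y : X, Measurable fun g : G => g⁻¹ • y := measurable_inv_smul_const
  have hA : ∀ A ∈ 𝒜, MeasurableSet A := fun A hA => by
    rw [hgen]; exact MeasurableSpace.measurableSet_generateFrom hA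
  have hmap : ∀ A ∈ 𝒜, ν.map (fun g => g⁻¹ • (h • x)) A = ν.map (fun g => g⁻¹ • x) A := by
    intro A hAm
    have := heq A hAm
    rw [orbitAverage_eq_toReal hφ h0 (hA A hAm),
      orbitAverage_eq_toReal hφ h0 (hA A hAm)] at this
    exact (ENNReal.toReal_eq_toReal_iff' (measure_ne_top _ _) (measure_ne_top _ _)).1 this
  have hEq : ν.map (fun g => g⁻¹ • (h • x)) = ν.map (fun g => g⁻¹ • x) :=
    ext_of_generate_finite 𝒜 hgen hpi hmap (hmap _ huniv)
  have hinj : ∀ y : X, Function.Injective fun g : G => g⁻¹ • y :=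
    fun y a b hab => inv_injective (hf y _ _ hab)
  have hso : IsOpen (Function.support φ) := hφ.isOpen_support
  have hS : MeasurableSet ((fun g : G => g⁻¹ • x) '' Function.support φ) :=
    hso.measurableSet.image_of_measurable_injOn (hm x) (hinj x).injOn
  have hpos : ν (Function.support φ) ≠ 0 := by
    intro hzero
    rw [hν, withDensity_apply_eq_zero (by fun_prop)] at hzero
    refine (hso.measure_pos (Measure.haar : Measure G) ⟨1, by simp [h1]⟩).ne' ?_
    refine measure_mono_null (t := _ ∩ Function.support φ) (fun g hg => ⟨?_, hg⟩) hzero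
    have : 0 < φ g := lt_of_le_of_ne (h0 g) (Ne.symm hg)
    simpa using this
  have hνS : ν ((fun g : G => g⁻¹ • (h • x)) ⁻¹' ((fun g : G => g⁻¹ • x) '' Function.support φ))
      ≠ 0 := by
    rw [← Measure.map_apply (hm _) hS, hEq, Measure.map_apply (hm _) hS,
      Set.preimage_image_eq _ (hinj x)]
    exact hpos
  have hνc : ν (Function.support φ)ᶜ = 0 := by
    rw [hν, withDensity_apply_eq_zero (by fun_prop)]
    convert measure_empty (μ := (Measure.haar : Measure G))
    ext g
    simp only [Set.mem_inter_iff, Set.mem_ofPred_eq, Set.mem_compl_iff, Function.mem_support,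
      not_not, Set.mem_empty_iff_false, iff_false, not_and]
    intro hg hg0
    simp [hg0] at hg
  have hne : ((fun g : G => g⁻¹ • (h • x)) ⁻¹' ((fun g : G => g⁻¹ • x) '' Function.support φ) ∩
      Function.support φ).Nonempty := by
    by_contra hemp
    rw [Set.not_nonempty_iff_eq_empty, ← Set.disjoint_iff_inter_eq_empty] at hemp
    exact hνS (measure_mono_null hemp.subset_compl_right hνc)
  obtain ⟨a, ⟨b, hb, hba⟩, ha⟩ := hne
  refine ⟨a, ha, b, hb, ?_⟩
  have : b⁻¹ = a⁻¹ * h := hf x _ _ (by simpa [mul_smul] using hba)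
  rw [this, mul_inv_cancel_left]

/-- There are countably many Borel functions on a free Borel `G`-space which are continuous along
orbits and separate the points of every orbit. -/
theorem exists_orbit_continuous_separating [StandardBorelSpace X] (hf : IsFreeAction G X) :
    ∃ Φ : ℕ → X → ℝ, (∀ k, Measurable (Φ k)) ∧
      (∀ k x, Continuous fun g : G => Φ k (g • x)) ∧
      ∀ (x : X) (g : G), (∀ k, Φ k (g • x) = Φ k x) → g = 1 := by
  obtain ⟨𝒜, hcount, hpi, hgen, huniv⟩ := exists_countable_isPiSystem_generateFrom X
  have hA : ∀ A ∈ 𝒜, MeasurableSet A := fun A hA => by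
    rw [hgen]; exact MeasurableSpace.measurableSet_generateFrom hA
  obtain ⟨V, hV⟩ := (𝓝 (1 : G)).exists_antitone_basis
  choose φ h1 hc h0 hφV using fun i => exists_bump_subset (hV.mem i)
  have : Countable 𝒜 := hcount
  have : Nonempty 𝒜 := ⟨⟨_, huniv⟩⟩
  obtain ⟨e, he⟩ := exists_surjective_nat (ℕ × 𝒜)
  refine ⟨fun k => orbitAverage (φ (e k).1) (e k).2, fun k => ?_, fun k x => ?_, ?_⟩
  · exact measurable_orbitAverage (φ _).continuous (hc _) (h0 _) (hA _ (e k).2.2)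
  · exact continuous_orbitAverage_smul (φ _).continuous (hc _) (hA _ (e k).2.2) x
  · intro x g hg
    by_contra hne
    -- A bump supported in a `W` with `g ∉ W * W⁻¹` tells `g • x` from `x`.
    obtain ⟨W, hWo, hW1, hW⟩ := exists_isOpen_div_mem
      (isOpen_compl_singleton.mem_nhds (Ne.symm hne) : ({g}ᶜ : Set G) ∈ 𝓝 1)
    obtain ⟨i, -, hi⟩ := hV.1.mem_iff.1 (hWo.mem_nhds hW1)
    obtain ⟨a, ha, b, hb, hab⟩ := div_mem_of_orbitAverage_eq hf hpi hgen huniv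
      (φ i).continuous (hc i) (h0 i) (h1 i) (h := g) (x := x) (fun A hAm => by
        obtain ⟨k, hk⟩ := he (i, ⟨A, hAm⟩)
        simpa only [hk] using hg k)
    exact hW a (hi (hφV i ha)) b (hi (hφV i hb)) hab.symm

end OrbitContinuous

/-! ### Projections along compact sets -/

section CompactProjection

/-- Projections along a compact set of closed conditions which are Borel in the parameter are
Borel. -/
theorem measurableSet_exists_mem_le {G Z : Type*} [TopologicalSpace G]
    [SecondCountableTopology G] [MeasurableSpace Z] {K : Set G} (hK : IsCompact K)
    {H : G → Z → ℝ} (hc : ∀ z, Continuous fun g => H g z) (hm : ∀ g, Measurable (H g)) (r : ℝ) :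
    MeasurableSet {z | ∃ g ∈ K, H g z ≤ r} := by
  rcases K.eq_empty_or_nonempty with rfl | hne
  · simp
  have : Nonempty K := hne.to_subtype
  have key : {z | ∃ g ∈ K, H g z ≤ r} = ⋂ n : ℕ, ⋃ i : ℕ,
      {z | H (TopologicalSpace.denseSeq K i) z < r + 1 / (n + 1 : ℝ)} := by
    ext z
    simp only [Set.mem_ofPred_eq, Set.mem_iInter, Set.mem_iUnion]
    constructor
    · rintro ⟨g, hg, hgz⟩ n
      have hn : (0 : ℝ) < 1 / (n + 1 : ℝ) := Nat.one_div_pos_of_nat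
      have ho : IsOpen {k : K | H k z < r + 1 / (n + 1 : ℝ)} :=
        isOpen_lt ((hc z).comp continuous_subtype_val) continuous_const
      obtain ⟨_, hk, i, rfl⟩ := (TopologicalSpace.denseRange_denseSeq K).inter_open_nonempty _ ho
        ⟨⟨g, hg⟩, show H g z < _ by linarith⟩
      exact ⟨i, hk⟩
    · intro h
      obtain ⟨g, hg, hmin⟩ := hK.exists_isMinOn hne (hc z).continuousOn
      refine ⟨g, hg, le_of_not_gt fun hlt => ?_⟩
      obtain ⟨n, hn⟩ := exists_nat_one_div_lt (sub_pos.2 hlt)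
      obtain ⟨i, hi⟩ := h n
      have := hmin (TopologicalSpace.denseSeq K i).2
      simp only [Set.mem_ofPred_eq] at this
      linarith
  rw [key]
  exact MeasurableSet.iInter fun n => MeasurableSet.iUnion fun i =>
    measurableSet_lt (hm _) measurable_const

end CompactProjection

/-! ### Gap functions and lexicographic minima -/

section LexMinimal

variable {G : Type*} [Group G] [TopologicalSpace G] [IsTopologicalGroup G]
  {X : Type*} [MulAction G X]

/-- How much closer than `r` the values of `F` on `Q • x` come to `F x`: this vanishes if and only
if they all have distance at least `r` from `F x`. -/
noncomputable def gapDefect {E : Type*} [PseudoMetricSpace E] (Q : Set G) (F : X → E) (r : ℝ)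
    (x : X) : ℝ :=
  sSup ((fun q : G => max (r - dist (F x) (F (q • x))) 0) '' Q)

section Gap

variable {E : Type*} [PseudoMetricSpace E] {Q : Set G} {F : X → E} {r : ℝ}

theorem gapDefect_le_iff {s : ℝ} (hs : 0 ≤ s) {x : X} :
    gapDefect Q F r x ≤ s ↔ ∀ q ∈ Q, r - dist (F x) (F (q • x)) ≤ s := by
  have hb : BddAbove ((fun q : G => max (r - dist (F x) (F (q • x))) 0) '' Q) := by
    refine ⟨max r 0, ?_⟩
    rintro _ ⟨q, -, rfl⟩
    exact max_le_max_right 0 (sub_le_self _ dist_nonneg)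
  constructor
  · intro h q hq
    exact (le_max_left _ _).trans ((le_csSup hb ⟨q, hq, rfl⟩).trans h)
  · intro h
    -- `Q` may be empty, and then the supremum is `0` by default; this is why `0 ≤ s` is needed.
    refine Real.sSup_le ?_ hs
    rintro _ ⟨q, hq, rfl⟩
    exact max_le (h q hq) hs

theorem gapDefect_nonneg (x : X) : 0 ≤ gapDefect Q F r x := by
  refine Real.sSup_nonneg ?_
  rintro _ ⟨q, -, rfl⟩
  exact le_max_right _ _

theorem continuous_gapDefect_smul (hQ : IsCompact Q) (hF : ∀ x, Continuous fun g : G => F (g • x))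
    (x : X) : Continuous fun g : G => gapDefect Q F r (g • x) := by
  refine hQ.continuous_sSup (f := fun (g q : G) => max (r - dist (F (g • x)) (F (q • g • x))) 0) ?_
  have h2 : Continuous fun p : G × G => F (p.2 • p.1 • x) := by
    simp_rw [smul_smul]
    exact (hF x).comp (continuous_snd.mul continuous_fst)
  exact (continuous_const.sub (((hF x).comp continuous_fst).dist h2)).max continuous_const

theorem measurable_gapDefect [SecondCountableTopology G] [MeasurableSpace X]
    [MeasurableSpace E] [BorelSpace E] [SecondCountableTopology E]
    (hQ : IsCompact Q) (hF : ∀ x, Continuous fun g : G => F (g • x)) (hFm : Measurable F)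
    (hs : ∀ g : G, Measurable fun x : X => g • x) : Measurable (gapDefect Q F r) := by
  refine measurable_of_Ioi fun s => ?_
  rcases lt_or_ge s 0 with h | h
  · convert MeasurableSet.univ
    exact Set.eq_univ_of_forall fun x => h.trans_le (gapDefect_nonneg x)
  · have : gapDefect Q F r ⁻¹' Set.Ioi s =
        ⋃ n : ℕ, {x | ∃ q ∈ Q, dist (F x) (F (q • x)) ≤ r - s - 1 / (n + 1 : ℝ)} := by
      ext x
      simp only [Set.mem_preimage, Set.mem_Ioi, Set.mem_iUnion, Set.mem_ofPred_eq]
      rw [← not_le, gapDefect_le_iff h]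
      push Not
      constructor
      · rintro ⟨q, hq, hlt⟩
        obtain ⟨n, hn⟩ := exists_nat_one_div_lt (sub_pos.2 hlt)
        exact ⟨n, q, hq, by linarith⟩
      · rintro ⟨n, q, hq, hle⟩
        have : (0 : ℝ) < 1 / (n + 1 : ℝ) := Nat.one_div_pos_of_nat
        exact ⟨q, hq, by linarith⟩
    rw [this]
    exact MeasurableSet.iUnion fun n => measurableSet_exists_mem_le hQ
      (fun x => continuous_const.dist (hF x)) (fun g => hFm.dist (hFm.comp (hs g))) _

end Gap

/-- The points of `A` whose `Φ`-value is lexicographically minimal among the points of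
`K • x ∩ A`. -/
def lexMinimal (K : Set G) (Φ : ℕ → X → ℝ) (A : Set X) : Set X :=
  {x | x ∈ A ∧ ∀ k, ∀ g ∈ K, g • x ∈ A → (∀ i < k, Φ i (g • x) ≤ Φ i x) → Φ k x ≤ Φ k (g • x)}

/-- Failure of minimality is a projection along `K`. The margin `1 / (n + 1)` makes its strict
inequality closed, and a sum of nonnegative defects packs all its conditions into one continuous
function being at most `0`. -/
theorem measurableSet_lexMinimal [SecondCountableTopology G] [MeasurableSpace X]
    (hs : ∀ g : G, Measurable fun x : X => g • x) {K : Set G} (hK : IsCompact K)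
    {Φ : ℕ → X → ℝ} (hΦ : ∀ k x, Continuous fun g : G => Φ k (g • x))
    (hΦm : ∀ k, Measurable (Φ k)) {a : X → ℝ} (ha : ∀ x, Continuous fun g : G => a (g • x))
    (ham : Measurable a) : MeasurableSet (lexMinimal K Φ {x | a x ≤ 0}) := by
  have : lexMinimal K Φ {x | a x ≤ 0} = {x | a x ≤ 0} \ ⋃ (k : ℕ) (n : ℕ),
      {x | ∃ g ∈ K, max (a (g • x)) 0 + ∑ i ∈ Finset.range k, max (Φ i (g • x) - Φ i x) 0 +
        max (Φ k (g • x) - Φ k x + 1 / (n + 1 : ℝ)) 0 ≤ 0} := by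
    have key : ∀ (x : X) (g : G) (k n : ℕ),
        max (a (g • x)) 0 + ∑ i ∈ Finset.range k, max (Φ i (g • x) - Φ i x) 0 +
        max (Φ k (g • x) - Φ k x + 1 / (n + 1 : ℝ)) 0 ≤ 0 ↔
        a (g • x) ≤ 0 ∧ (∀ i < k, Φ i (g • x) ≤ Φ i x) ∧
          Φ k (g • x) - Φ k x + 1 / (n + 1 : ℝ) ≤ 0 := by
      intro x g k n
      have h1 : 0 ≤ max (a (g • x)) 0 := le_max_right _ _
      have h2 : ∀ i ∈ Finset.range k, 0 ≤ max (Φ i (g • x) - Φ i x) 0 := fun i _ => le_max_right _ _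
      have h3 : 0 ≤ max (Φ k (g • x) - Φ k x + 1 / (n + 1 : ℝ)) 0 := le_max_right _ _
      have h4 := Finset.sum_nonneg h2
      constructor
      · intro h
        have h5 := (Finset.sum_eq_zero_iff_of_nonneg h2).1 (by linarith)
        exact ⟨by linarith [le_max_left (a (g • x)) 0], fun i hi =>
          sub_nonpos.1 ((le_max_left _ _).trans (h5 i (Finset.mem_range.2 hi)).le),
          (le_max_left _ 0).trans (by linarith)⟩
      · rintro ⟨h5, h6, h7⟩
        rw [max_eq_right h5, max_eq_right h7, Finset.sum_eq_zero fun i hi =>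
          max_eq_right (sub_nonpos.2 (h6 i (Finset.mem_range.1 hi)))]
        simp
    ext x
    simp only [lexMinimal, Set.mem_ofPred_eq, Set.mem_sdiff, Set.mem_iUnion, key, not_exists,
      not_and, not_le]
    refine and_congr_right fun _ => ⟨?_, ?_⟩
    · intro h k n g hg hga hlt
      have := h k g hg hga hlt
      have : (0 : ℝ) < 1 / (n + 1 : ℝ) := Nat.one_div_pos_of_nat
      linarith
    · intro h k g hg hga hlt
      by_contra hcon
      push Not at hcon
      obtain ⟨n, hn⟩ := exists_nat_one_div_lt (sub_pos.2 hcon)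
      have := h k n g hg hga hlt
      linarith
  rw [this]
  refine (measurableSet_le ham measurable_const).diff (MeasurableSet.iUnion fun k =>
    MeasurableSet.iUnion fun n => measurableSet_exists_mem_le hK ?_ ?_ _)
  · intro x
    have hd : ∀ (k : ℕ) (c : ℝ), Continuous fun g : G => max (Φ k (g • x) - Φ k x + c) 0 :=
      fun k c => (((hΦ k x).sub continuous_const).add continuous_const).max continuous_const
    exact (((ha x).max continuous_const).add
      (continuous_finsetSum _ fun i _ => by simpa using hd i 0)).add (hd k _)
  · intro g
    have := ham.comp (hs g)
    have := fun k => (hΦm k).comp (hs g)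
    simp only [Function.comp_def] at *
    fun_prop

/-- Minimising `Φ 0`, then `Φ 1` among its minimisers, and so on gives decreasing nonempty compact
sets; any `g` in their intersection works. -/
theorem exists_smul_mem_lexMinimal [T2Space G] {K : Set G} (hK : IsCompact K)
    {Φ : ℕ → X → ℝ} (hΦ : ∀ k x, Continuous fun g : G => Φ k (g • x)) {A : Set X}
    (hA : ∀ x, IsClosed {g : G | g • x ∈ A}) {x : X} (hx : x ∈ A) (h1 : (1 : G) ∈ K)
    (hKA : ∀ y ∈ A, ∀ g ∈ K * K, g • y ∈ A → g ∈ K) :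
    ∃ g ∈ K, g • x ∈ lexMinimal K Φ A := by
  let T : ℕ → Set G := fun n => Nat.rec (K ∩ {g | g • x ∈ A})
    (fun k S => {g | g ∈ S ∧ ∀ g' ∈ S, Φ k (g • x) ≤ Φ k (g' • x)}) n
  have hTs : ∀ k, T (k + 1) = {g | g ∈ T k ∧ ∀ g' ∈ T k, Φ k (g • x) ≤ Φ k (g' • x)} :=
    fun _ => rfl
  have hsub : ∀ k, T (k + 1) ⊆ T k := fun k g hg => hg.1
  have hTc : ∀ k, IsCompact (T k) ∧ (T k).Nonempty := by
    intro k
    induction k with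
    | zero => exact ⟨hK.inter_right (hA x), 1, h1, by simpa using hx⟩
    | succ k ih =>
      refine ⟨?_, ?_⟩
      · have : T (k + 1) = T k ∩ ⋂ g' ∈ T k, {g | Φ k (g • x) ≤ Φ k (g' • x)} := by
          ext g; simp [hTs]
        rw [this]
        exact ih.1.inter_right (isClosed_biInter fun g' _ =>
          isClosed_le (hΦ k x) continuous_const)
      · obtain ⟨g, hg, hmin⟩ := ih.1.exists_isMinOn ih.2 (hΦ k x).continuousOn
        exact ⟨g, hg, fun g' hg' => hmin hg'⟩
  obtain ⟨g, hg⟩ := IsCompact.nonempty_iInter_of_sequence_nonempty_isCompact_isClosed T hsub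
    (fun k => (hTc k).2) (hTc 0).1 (fun k => (hTc k).1.isClosed)
  rw [Set.mem_iInter] at hg
  refine ⟨g, (hg 0).1, (hg 0).2, fun k h hh hhA hlt => ?_⟩
  rw [smul_smul] at hhA hlt ⊢
  -- Competitors of `g • x` come from `K * g`, not `K`; `hKA` puts them back in `K`, the domain of
  -- the minimisation.
  have hmem : ∀ i ≤ k, h * g ∈ T i := by
    intro i hi
    induction i with
    | zero => exact ⟨hKA x hx _ (Set.mul_mem_mul hh (hg 0).1) hhA, hhA⟩
    | succ i ih =>
      refine ⟨ih (by lia), fun g' hg' => ?_⟩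
      have h1 := hlt i hi
      exact h1.trans ((hg (i + 1)).2 g' hg')
  exact (hg (k + 1)).2 _ (hmem k le_rfl)

/-- Both `g` and `g⁻¹` lie in `K`, so the two points are minimal against each other; all `Φ`-values
agree, and separation gives `g = 1`. -/
theorem isSparse_lexMinimal {K V : Set G} (hKs : K⁻¹ = K) {Φ : ℕ → X → ℝ} {A : Set X}
    (hΦ1 : ∀ (x : X) (g : G), (∀ k, Φ k (g • x) = Φ k x) → g = 1)
    (hKA : ∀ y ∈ A, ∀ g ∈ V, g • y ∈ A → g ∈ K) : IsSparse V (lexMinimal K Φ A) := by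
  intro x hx g hg hgx
  have hgK := hKA x hx.1 g hg hgx.1
  have hgK' : g⁻¹ ∈ K := by rw [← hKs]; simpa using hgK
  have : g = 1 := by
    refine hΦ1 x g fun k => ?_
    induction k using Nat.strong_induction_on with
    | _ k ih =>
      refine le_antisymm ?_ (hx.2 k g hgK hgx.1 fun i hi => (ih i hi).le)
      have := hgx.2 k g⁻¹ hgK' (by simpa using hx.1) (fun i hi => by simpa using (ih i hi).ge)
      simpa using this
  rw [this, one_smul]

end LexMinimal

/-! ### Existence of lacunary cocompact cross sections -/

section Existence

variable {G : Type*} [Group G] [TopologicalSpace G] [IsTopologicalGroup G] [PolishSpace G]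
  [LocallyCompactSpace G] [MeasurableSpace G] [BorelSpace G]
  {X : Type*} [MeasurableSpace X] [StandardBorelSpace X] [MulAction G X] [MeasurableSMul₂ G X]

/-- As `m` grows there are more coordinates and a smaller tolerance, so the sets of failures
decrease. By compactness a common failure would be an element of `Q` preserving every `Φ k`, that
is, `1`. -/
theorem exists_lt_dist_of_isCompact {Φ : ℕ → X → ℝ}
    (hΦ : ∀ k x, Continuous fun g : G => Φ k (g • x))
    (hΦ1 : ∀ (x : X) (g : G), (∀ k, Φ k (g • x) = Φ k x) → g = 1) {Q : Set G} (hQ : IsCompact Q)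
    (h1 : (1 : G) ∉ Q) (x : X) :
    ∃ m : ℕ, ∀ q ∈ Q, 1 / (m + 1 : ℝ) <
      dist (fun j : Fin m => Φ j x) (fun j : Fin m => Φ j (q • x)) := by
  by_contra! hcon
  let T : ℕ → Set G := fun m =>
    Q ∩ {q | dist (fun j : Fin m => Φ j x) (fun j : Fin m => Φ j (q • x)) ≤ 1 / (m + 1 : ℝ)}
  have hpos : ∀ m : ℕ, (0 : ℝ) ≤ 1 / (m + 1 : ℝ) := fun m => by positivity
  have hTm : ∀ m q, q ∈ T m ↔ q ∈ Q ∧ ∀ j < m, dist (Φ j x) (Φ j (q • x)) ≤ 1 / (m + 1 : ℝ) := by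
    intro m q
    simp only [T, Set.mem_inter_iff, Set.mem_ofPred_eq, dist_pi_le_iff (hpos m)]
    exact and_congr_right fun _ => ⟨fun h j hj => h ⟨j, hj⟩, fun h j => h j j.2⟩
  have hclosed : ∀ m, IsClosed {q : G |
      dist (fun j : Fin m => Φ j x) (fun j : Fin m => Φ j (q • x)) ≤ 1 / (m + 1 : ℝ)} := fun m =>
    isClosed_le (continuous_const.dist (continuous_pi fun j => hΦ j x)) continuous_const
  have hsub : ∀ m, T (m + 1) ⊆ T m := by
    intro m q hq
    rw [hTm] at hq ⊢
    refine ⟨hq.1, fun j hj => (hq.2 j (by lia)).trans ?_⟩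
    exact one_div_le_one_div_of_le (by positivity) (by push_cast; linarith)
  obtain ⟨q, hq⟩ := IsCompact.nonempty_iInter_of_sequence_nonempty_isCompact_isClosed T hsub hcon
    (hQ.inter_right (hclosed 0)) (fun m => hQ.isClosed.inter (hclosed m))
  rw [Set.mem_iInter] at hq
  have : q = 1 := by
    refine hΦ1 x q fun k => ?_
    rw [eq_comm, ← dist_le_zero]
    refine le_of_forall_pos_le_add fun ε hε => ?_
    obtain ⟨n, hn⟩ := exists_nat_one_div_lt hε
    have h2 := ((hTm _ q).1 (hq (max (k + 1) n))).2 k (by lia)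
    have h3 : (1 : ℝ) / ((max (k + 1) n : ℕ) + 1 : ℝ) ≤ 1 / (n + 1 : ℝ) :=
      one_div_le_one_div_of_le (by positivity) (by gcongr; exact le_max_right _ _)
    linarith
  exact h1 (this ▸ (hq 0).1)

/-- Countably many sparse Borel sets whose `K`-saturations cover the space. -/
theorem exists_seq_isSparse (hf : IsFreeAction G X) {K : Set G} (hK : IsCompact K)
    (hK1 : K ∈ 𝓝 (1 : G)) (hKs : K⁻¹ = K) :
    ∃ C : ℕ → Set X, (∀ k, MeasurableSet (C k)) ∧ (∀ k, IsSparse (K * K) (C k)) ∧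
      ∀ x, ∃ k, ∃ g ∈ K, g • x ∈ C k := by
  obtain ⟨Φ, hΦm, hΦ, hΦ1⟩ := exists_orbit_continuous_separating (G := G) hf
  have hQ : IsCompact ((K * K) \ interior K) := (hK.mul hK).diff isOpen_interior
  have h1Q : (1 : G) ∉ (K * K) \ interior K := fun h => h.2 (mem_interior_iff_mem_nhds.2 hK1)
  generalize hQe : (K * K) \ interior K = Q at hQ h1Q
  let F : (m : ℕ) → X → (Fin m → ℝ) := fun m x j => Φ j x
  have hF : ∀ m x, Continuous fun g : G => F m (g • x) := fun m x => continuous_pi fun j => hΦ j x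
  have hFm : ∀ m, Measurable (F m) := fun m => measurable_pi_lambda _ fun j => hΦm j
  let r : ℕ → ℝ := fun m => 1 / (m + 1 : ℝ)
  have hr : ∀ m, 0 < r m := fun m => Nat.one_div_pos_of_nat
  let a : ℕ → ℕ → X → ℝ := fun m i x =>
    max (dist (F m x) (TopologicalSpace.denseSeq (Fin m → ℝ) i) - r m / 4) (gapDefect Q (F m) (r m) x)
  have ha : ∀ m i x, Continuous fun g : G => a m i (g • x) := fun m i x =>
    (((hF m x).dist continuous_const).sub continuous_const).max
      (continuous_gapDefect_smul hQ (hF m) x)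
  have ham : ∀ m i, Measurable (a m i) := fun m i =>
    (((hFm m).dist measurable_const).sub measurable_const).max
      (measurable_gapDefect hQ (hF m) (hFm m) fun g => measurable_const_smul g)
  have hale : ∀ m i x, a m i x ≤ 0 ↔ dist (F m x) (TopologicalSpace.denseSeq (Fin m → ℝ) i) -
      r m / 4 ≤ 0 ∧ gapDefect Q (F m) (r m) x ≤ 0 := fun m i x => max_le_iff
  have hKA : ∀ m i, ∀ y ∈ {x | a m i x ≤ 0}, ∀ g ∈ K * K, g • y ∈ {x | a m i x ≤ 0} → g ∈ K := by
    intro m i y hy g hg hgy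
    by_contra hgK
    have hgQ : g ∈ Q := hQe ▸ ⟨hg, fun h => hgK (interior_subset h)⟩
    obtain ⟨h1, h2⟩ := (hale m i y).1 hy
    obtain ⟨h3, -⟩ := (hale m i _).1 hgy
    have h4 := (gapDefect_le_iff le_rfl).1 h2 g hgQ
    -- Both values are within `r m / 4` of one centre, hence at most `r m / 2` apart, while zero gap
    -- defect requires distance at least `r m`.
    have h5 := dist_triangle_right (F m y) (F m (g • y)) (TopologicalSpace.denseSeq (Fin m → ℝ) i)
    linarith [hr m]
  refine ⟨fun k => lexMinimal K Φ {x | a k.unpair.1 k.unpair.2 x ≤ 0}, fun k => ?_, fun k => ?_,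
    fun x => ?_⟩
  · exact measurableSet_lexMinimal (fun g => measurable_const_smul g) hK hΦ hΦm (ha _ _) (ham _ _)
  · exact isSparse_lexMinimal hKs hΦ1 (hKA _ _)
  · obtain ⟨m, hm⟩ := exists_lt_dist_of_isCompact hΦ hΦ1 hQ h1Q x
    obtain ⟨_, hd, i, rfl⟩ := (TopologicalSpace.denseRange_denseSeq (Fin m → ℝ)).inter_open_nonempty
      _ Metric.isOpen_ball ⟨F m x, Metric.mem_ball_self (by linarith [hr m] : 0 < r m / 4)⟩
    have hx : x ∈ {x | a m i x ≤ 0} := by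
      refine max_le ?_ ((gapDefect_le_iff le_rfl).2 fun q hq => ?_)
      · rw [Metric.mem_ball, dist_comm] at hd
        linarith
      · exact sub_nonpos.2 (hm q hq).le
    have hcl : ∀ y : X, IsClosed {g : G | g • y ∈ {x | a m i x ≤ 0}} := fun y =>
      isClosed_Iic.preimage (ha m i y)
    obtain ⟨g, hg, hgx⟩ := exists_smul_mem_lexMinimal hK hΦ hcl hx (mem_of_mem_nhds hK1) (hKA m i)
    exact ⟨Nat.pair m i, g, hg, by simpa using hgx⟩

/-- Greedy union of a sequence of sets, keeping it `V`-sparse. -/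
def greedyUnion (V : Set G) (C : ℕ → Set X) : ℕ → Set X
  | 0 => ∅
  | k + 1 => greedyUnion V C k ∪ {x | x ∈ C k ∧ ∀ v ∈ V, v • x ∉ greedyUnion V C k}

theorem isSparse_greedyUnion {V : Set G} (hVs : V⁻¹ = V) {C : ℕ → Set X}
    (hC : ∀ k, IsSparse V (C k)) (k : ℕ) : IsSparse V (greedyUnion V C k) := by
  induction k with
  | zero => exact fun x hx => hx.elim
  | succ k ih =>
    rintro x (hx | hx) g hg (hgx | hgx)
    · exact ih x hx g hg hgx
    · exact (hgx.2 g⁻¹ (by rw [← hVs]; simpa using hg) (by simpa using hx)).elim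
    · exact (hx.2 g hg hgx).elim
    · exact hC k x hx.1 g hg hgx.1

theorem monotone_greedyUnion (V : Set G) (C : ℕ → Set X) : Monotone (greedyUnion V C) :=
  monotone_nat_of_le_succ fun _ => Set.subset_union_left

theorem measurableSet_exists_smul_mem {V W : Set G} (hf : IsFreeAction G X) (hV : V ∈ 𝓝 (1 : G))
    (hW : MeasurableSet W) {C : Set X} (hC : MeasurableSet C) (hCV : IsSparse V C) :
    MeasurableSet {x : X | ∃ g : G, g ∈ W ∧ g • x ∈ C} := by
  refine measurableSet_exists_of_separatedBy hV (P := fun (g : G) (x : X) => g ∈ W ∧ g • x ∈ C)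
    ((hW.preimage measurable_fst).inter (hC.preimage measurable_smul)) fun x => ?_
  exact (hCV.separatedBy hf x).mono fun g hg => hg.2

theorem measurableSet_greedyUnion {V : Set G} (hf : IsFreeAction G X) (hV : V ∈ 𝓝 (1 : G))
    (hVm : MeasurableSet V) (hVs : V⁻¹ = V) {C : ℕ → Set X} (hCm : ∀ k, MeasurableSet (C k))
    (hC : ∀ k, IsSparse V (C k)) (k : ℕ) : MeasurableSet (greedyUnion V C k) := by
  induction k with
  | zero => exact MeasurableSet.empty
  | succ k ih =>
    have h := measurableSet_exists_smul_mem hf hV hVm ih (isSparse_greedyUnion hVs hC k)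
    have heq : greedyUnion V C (k + 1) = greedyUnion V C k ∪
        (C k ∩ {x | ∃ g, g ∈ V ∧ g • x ∈ greedyUnion V C k}ᶜ) := by
      ext x
      simp [greedyUnion]
    rw [heq]
    exact ih.union ((hCm k).inter h.compl)

/-- Every free Borel action of a locally compact Polish group has a lacunary cocompact cross
section. -/
theorem exists_isLacunaryCocompactCrossSection (hf : IsFreeAction G X) :
    ∃ C : Set X, IsLacunaryCocompactCrossSection G C := by
  obtain ⟨K, hK1, hK, hKs⟩ : ∃ K ∈ 𝓝 (1 : G), IsCompact K ∧ K⁻¹ = K := by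
    obtain ⟨L, hL, hL1⟩ := exists_compact_mem_nhds (1 : G)
    refine ⟨L ∩ L⁻¹, Filter.inter_mem hL1 (inv_mem_nhds_one G hL1), hL.inter_right hL.inv.isClosed,
      by rw [Set.inter_inv, inv_inv, Set.inter_comm]⟩
  have h1 : (1 : G) ∈ K := mem_of_mem_nhds hK1
  obtain ⟨C, hCm, hC, hcov⟩ := exists_seq_isSparse (X := X) hf hK hK1 hKs
  have hV : K * K ∈ 𝓝 (1 : G) := Filter.mem_of_superset hK1 fun g hg =>
    ⟨g, hg, 1, h1, mul_one g⟩
  have hVs : (K * K)⁻¹ = K * K := by rw [mul_inv_rev, hKs]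
  have hS := isSparse_greedyUnion hVs hC
  have hsp : IsSparse (K * K) (⋃ k, greedyUnion (K * K) C k) := by
    intro x hx g hg hgx
    obtain ⟨i, hi⟩ := Set.mem_iUnion.1 hx
    obtain ⟨j, hj⟩ := Set.mem_iUnion.1 hgx
    exact hS (max i j) x (monotone_greedyUnion _ _ (le_max_left i j) hi) g hg
      (monotone_greedyUnion _ _ (le_max_right i j) hj)
  refine ⟨⋃ k, greedyUnion (K * K) C k, hsp.isCrossSection hV hf (MeasurableSet.iUnion fun k =>
    measurableSet_greedyUnion hf hV (hK.mul hK).measurableSet hVs hCm hC k),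
    hsp.isLacunary hK1 hKs hf, K * (K * K), ?_, hK.mul (hK.mul hK), ?_⟩
  · exact Filter.mem_of_superset hK1 fun g hg => ⟨g, hg, 1, ⟨1, h1, 1, h1, mul_one 1⟩, mul_one g⟩
  · refine Set.eq_univ_of_forall fun x => ?_
    obtain ⟨k, g, hg, hgx⟩ := hcov x
    -- Maximality: a point of `C k` is either `K * K`-close to what has been chosen or is itself
    -- added at stage `k + 1`.
    have key : ∃ v ∈ K * K, v • g • x ∈ ⋃ k, greedyUnion (K * K) C k := by
      by_cases h : ∃ v ∈ K * K, v • g • x ∈ greedyUnion (K * K) C k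
      · obtain ⟨v, hv, hvx⟩ := h
        exact ⟨v, hv, Set.mem_iUnion.2 ⟨k, hvx⟩⟩
      · push Not at h
        exact ⟨1, ⟨1, h1, 1, h1, mul_one 1⟩, Set.mem_iUnion.2 ⟨k + 1, Or.inr
          ⟨by simpa using hgx, by simpa using h⟩⟩⟩
    obtain ⟨v, hv, hvx⟩ := key
    refine ⟨g⁻¹ * v⁻¹, Set.mul_mem_mul ?_ ?_, v • g • x, hvx, ?_⟩
    · rw [← hKs]; simpa using hg
    · rw [← hVs]; exact Set.inv_mem_inv.2 hv
    · simp [mul_smul]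

end Existence

/-! ### Truncating a finite filtration to bounded classes -/

section BoundedPart

variable {G : Type*} [Group G] {X : Type*} [MulAction G X] {C : Set X}

/-- Every `g : G` moving a point of the `r`-class of `c` to a point of this class is in `L`. -/
def HasBoundedClass (L : Set G) (r : Setoid C) (c : C) : Prop :=
  ∀ a b : C, r c a → r a b → ∀ g : G, g • (a : X) = b → g ∈ L

/-- The part of the first `n + 1` members of a sequence of equivalence relations consisting of the
`L`-bounded classes. -/
def boundedPart (L : Set G) (F : ℕ → Setoid C) (hF : Monotone F) (n : ℕ) : Setoid C where
  r c d := c = d ∨ ∃ m ≤ n, F m c d ∧ HasBoundedClass L (F m) c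
  iseqv :=
    { refl := fun _ => Or.inl rfl
      symm := by
        rintro c d (rfl | ⟨m, hm, hcd, hb⟩)
        · exact Or.inl rfl
        · exact Or.inr ⟨m, hm, (F m).symm hcd, fun a b ha => hb a b ((F m).trans hcd ha)⟩
      trans := by
        rintro c d e (rfl | ⟨m, hm, hcd, hb⟩) (rfl | ⟨m', hm', hde, hb'⟩)
        · exact Or.inl rfl
        · exact Or.inr ⟨m', hm', hde, hb'⟩
        · exact Or.inr ⟨m, hm, hcd, hb⟩
        · right
          -- The coarser relation contains both pairs, and boundedness of its class does not depend
          -- on the base point.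
          rcases le_total m m' with h | h
          · have hcd' : F m' c d := hF h hcd
            exact ⟨m', hm', (F m').trans hcd' hde, fun a b ha =>
              hb' a b ((F m').trans ((F m').symm hcd') ha)⟩
          · exact ⟨m, hm, (F m).trans hcd (hF h hde), hb⟩ }

theorem boundedPart_def {L : Set G} {F : ℕ → Setoid C} {hF : Monotone F} {n : ℕ} {c d : C} :
    boundedPart L F hF n c d ↔ c = d ∨ ∃ m ≤ n, F m c d ∧ HasBoundedClass L (F m) c :=
  Iff.rfl

/-- Keeping all indices `m ≤ n` matters here: a bounded class of `F n` may merge into an unbounded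
class of `F (n + 1)`, so using `F n` alone would lose monotonicity. -/
theorem boundedPart_mono {L L' : Set G} {F : ℕ → Setoid C} (hF : Monotone F) {n n' : ℕ}
    (hL : L ⊆ L') (hn : n ≤ n') : boundedPart L F hF n ≤ boundedPart L' F hF n' := by
  rintro c d (rfl | ⟨m, hm, hcd, hb⟩)
  · exact Or.inl rfl
  · exact Or.inr ⟨m, hm.trans hn, hcd, fun a b ha hab g hg => hL (hb a b ha hab g hg)⟩

theorem boundedPart_eq_or_mem {L : Set G} {F : ℕ → Setoid C} {hF : Monotone F} {n : ℕ} {c d : C}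
    (h : boundedPart L F hF n c d) : c = d ∨ ∀ g : G, g • (c : X) = d → g ∈ L := by
  rcases h with h | ⟨m, -, hcd, hb⟩
  · exact Or.inl h
  · exact Or.inr (hb c d ((F m).refl c) hcd)

end BoundedPart

/-! ### Measurability of truncations and a nearest-point selector -/

section Measurability

variable {G : Type*} [Group G] [TopologicalSpace G] [IsTopologicalGroup G] [PolishSpace G]
  [LocallyCompactSpace G] [MeasurableSpace G] [BorelSpace G]
  {X : Type*} [MeasurableSpace X] [StandardBorelSpace X] [MulAction G X] [MeasurableSMul₂ G X]
  {C : Set X} {V : Set G}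

theorem measurableSet_exists_smul_eq (hf : IsFreeAction G X) (hC : MeasurableSet C)
    (hV : V ∈ 𝓝 (1 : G)) (hCV : IsSparse V C) {W : Set G} (hW : MeasurableSet W)
    {R : Set (C × C)} (hR : MeasurableSet R) :
    MeasurableSet {c : C | ∃ g : G, g ∈ W ∧ ∃ d : C, g • (c : X) = d ∧ (c, d) ∈ R} := by
  have := hC.standardBorel
  have hR' : MeasurableSet (Prod.map Subtype.val Subtype.val '' R : Set (X × X)) :=
    ((MeasurableEmbedding.subtype_coe hC).prodMap
      (MeasurableEmbedding.subtype_coe hC)).measurableSet_image.2 hR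
  refine measurableSet_exists_of_separatedBy hV
    (P := fun (g : G) (c : C) => g ∈ W ∧ ∃ d : C, g • (c : X) = d ∧ (c, d) ∈ R) ?_ ?_
  · have hm : Measurable fun p : G × C => ((p.2 : X), p.1 • (p.2 : X)) :=
      (measurable_subtype_coe.comp measurable_snd).prodMk
        (measurable_fst.smul (measurable_subtype_coe.comp measurable_snd))
    convert (hW.preimage measurable_fst).inter (hm hR') using 1
    ext ⟨g, c⟩
    simp only [Set.mem_ofPred_eq, Set.mem_inter_iff, Set.mem_preimage, Set.mem_image, Prod.exists,
      Prod.map_apply, Prod.mk.injEq]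
    refine and_congr_right fun _ => ⟨?_, ?_⟩
    · rintro ⟨d, hd, h⟩
      exact ⟨c, d, h, rfl, hd.symm⟩
    · rintro ⟨c', d, h, hc, hd⟩
      exact ⟨d, hd.symm, Subtype.ext hc ▸ h⟩
  · intro c
    refine (hCV.separatedBy hf (c : X)).mono ?_
    rintro g ⟨-, d, hd, -⟩
    exact show g • (c : X) ∈ C from hd ▸ d.2

/-- Unboundedness is two successive projections along `G`: from `c` to a point `a` of its class,
then from `a` by an element outside `L`. Both have separated sections. -/
theorem measurableSet_hasBoundedClass (hf : IsFreeAction G X) (hC : MeasurableSet C)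
    (hV : V ∈ 𝓝 (1 : G)) (hCV : IsSparse V C) {L : Set G} (hL : MeasurableSet L)
    {r : Setoid C} (hr : IsBorelEquiv r) (hro : r ≤ orbitRelOn G C) :
    MeasurableSet {c : C | HasBoundedClass L r c} := by
  have h1 := measurableSet_exists_smul_eq hf hC hV hCV hL.compl hr
  have h2 := measurableSet_exists_smul_eq hf hC hV hCV MeasurableSet.univ
    (hr.inter (h1.preimage measurable_snd))
  convert h2.compl using 1
  ext c
  simp only [HasBoundedClass, Set.mem_ofPred_eq, Set.mem_compl_iff, Set.mem_univ, true_and,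
    Set.mem_inter_iff, Set.mem_preimage, not_exists, not_and]
  constructor
  · intro h g a _ hca k hk b hkb hab
    exact hk (h a b hca hab k hkb)
  · intro h a b hca hab g hg
    obtain ⟨k, hk⟩ : (a : X) ∈ MulAction.orbit G (c : X) :=
      (MulAction.orbitRel G X).symm (hro hca)
    by_contra hgL
    exact h k a hk hca g hgL b hg hab

theorem isBorelEquiv_boundedPart (hf : IsFreeAction G X) (hC : MeasurableSet C)
    (hV : V ∈ 𝓝 (1 : G)) (hCV : IsSparse V C) {L : Set G} (hL : MeasurableSet L)
    {F : ℕ → Setoid C} (hF : Monotone F) (hFb : ∀ m, IsBorelEquiv (F m))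
    (hFo : ∀ m, F m ≤ orbitRelOn G C) (n : ℕ) : IsBorelEquiv (boundedPart L F hF n) := by
  have := hC.standardBorel
  have : {p : C × C | boundedPart L F hF n p.1 p.2} = {p | p.1 = p.2} ∪
      ⋃ m ∈ Set.Iic n, {p | F m p.1 p.2} ∩ Prod.fst ⁻¹' {c | HasBoundedClass L (F m) c} := by
    ext p
    simp [boundedPart_def, and_left_comm]
  rw [IsBorelEquiv, this]
  exact (measurableSet_eq_fun measurable_fst measurable_snd).union
    (MeasurableSet.biUnion (Set.to_countable _) fun m _ => (hFb m).inter
      ((measurableSet_hasBoundedClass hf hC hV hCV hL (hFb m) (hFo m)).preimage measurable_fst))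

/-- A Borel choice of nearby points in a sparse set. -/
theorem exists_measurable_smul_mem (hf : IsFreeAction G X) (hC : MeasurableSet C)
    (hV : V ∈ 𝓝 (1 : G)) (hCV : IsSparse V C) {K : Set G} (hK : MeasurableSet K)
    (hKC : ∀ x : X, ∃ g ∈ K, g • x ∈ C) :
    ∃ π : X → C, Measurable π ∧ ∀ x, ∃ g ∈ K, (π x : X) = g • x := by
  classical
  obtain ⟨W, hW, h1, hWV⟩ := exists_isOpen_div_mem hV
  let T : ℕ → Set G := fun i => K ∩ {g | g * (TopologicalSpace.denseSeq G i)⁻¹ ∈ W}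
  have hT : ∀ i, MeasurableSet (T i) := fun i => hK.inter (hW.preimage (by fun_prop : Continuous
    fun g : G => g * (TopologicalSpace.denseSeq G i)⁻¹)).measurableSet
  have hD : ∀ i, ∀ B ⊆ C, MeasurableSet B → MeasurableSet {x : X | ∃ g, g ∈ T i ∧ g • x ∈ B} :=
    fun i B hBC hB => measurableSet_exists_smul_mem hf hV (hT i) hB
      fun x hx g hg hgx => hCV x (hBC hx) g hg (hBC hgx)
  have huniq : ∀ i (x : X) g h, g ∈ T i → h ∈ T i → g • x ∈ C → h • x ∈ C → g = h := by
    intro i x g h hg hh hgx hhx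
    refine hCV.separatedBy hf x g hgx h hhx ?_
    have := hWV _ hh.2 _ hg.2
    rwa [show h * (TopologicalSpace.denseSeq G i)⁻¹ * (g * (TopologicalSpace.denseSeq G i)⁻¹)⁻¹
      = h * g⁻¹ by group] at this
  have hex : ∀ x : X, ∃ i, ∃ g, g ∈ T i ∧ g • x ∈ C := fun x => by
    obtain ⟨g, hg, hgx⟩ := hKC x
    obtain ⟨i, hi⟩ := exists_seq_mul_inv_mem hW h1 g
    exact ⟨i, g, ⟨hg, hi⟩, hgx⟩
  -- The least index `i` whose piece `T i` moves `x` into `C` determines the group element, by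
  -- `huniq`.
  choose g hg hgx using fun x => Nat.find_spec (hex x)
  refine ⟨fun x => ⟨g x • x, hgx x⟩, fun B hB => ?_, fun x => ⟨g x, (hg x).1, rfl⟩⟩
  have hB' : MeasurableSet (Subtype.val '' B : Set X) := hC.subtype_image hB
  have hBC : Subtype.val '' B ⊆ C := Subtype.coe_image_subset C B
  have key : (fun x => (⟨g x • x, hgx x⟩ : C)) ⁻¹' B =
      ⋃ i, ({x : X | ∃ g, g ∈ T i ∧ g • x ∈ Subtype.val '' B} \
        ⋃ j ∈ Set.Iio i, {x : X | ∃ g, g ∈ T j ∧ g • x ∈ C}) := by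
    ext x
    simp only [Set.mem_preimage, Set.mem_iUnion, Set.mem_sdiff, Set.mem_ofPred_eq, Set.mem_Iio,
      exists_prop, not_exists, not_and]
    constructor
    · intro h
      exact ⟨Nat.find (hex x), ⟨g x, hg x, _, h, rfl⟩, fun j hj k hk hkx =>
        Nat.find_min (hex x) hj ⟨k, hk, hkx⟩⟩
    · rintro ⟨i, ⟨k, hk, hkx⟩, hmin⟩
      have hi : Nat.find (hex x) = i := by
        refine (Nat.find_eq_iff (hex x)).2 ⟨⟨k, hk, hBC hkx⟩, ?_⟩
        rintro j hj ⟨l, hl, hlx⟩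
        exact hmin j hj l hl hlx
      have hgk : g x = k := huniq i x _ _ (hi ▸ hg x) hk (hgx x) (hBC hkx)
      obtain ⟨b, hb, hbk⟩ := hkx
      have : b = ⟨g x • x, hgx x⟩ := Subtype.ext (hbk.trans (hgk ▸ rfl))
      exact this ▸ hb
  rw [key]
  exact MeasurableSet.iUnion fun i => (hD i _ hBC hB').diff
    (MeasurableSet.biUnion (Set.to_countable _) fun j _ => hD j C subset_rfl hC)

end Measurability

/-! ### From hyperfinite cross sections to equicompact filtrations -/

section Hypercompact

variable {G : Type*} [Group G] [TopologicalSpace G] [IsTopologicalGroup G] [PolishSpace G]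
  [LocallyCompactSpace G] [MeasurableSpace G] [BorelSpace G]
  {X : Type*} [MeasurableSpace X] [StandardBorelSpace X] [MulAction G X] [MeasurableSMul₂ G X]
  {C : Set X}

/-- By freeness a finite class involves only finitely many group elements. -/
theorem exists_hasBoundedClass (hf : IsFreeAction G X) (L : CompactExhaustion G) {r : Setoid C}
    {c : C} (hfin : {d | r c d}.Finite) :
    ∀ᶠ n in Filter.atTop, HasBoundedClass (L n) r c := by
  have h : ∀ a ∈ {d | r c d}, ∀ b ∈ {d | r c d}, ∀ᶠ n in Filter.atTop,
      ∀ g : G, g • (a : X) = b → g ∈ L n := by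
    intro a _ b _
    by_cases hab : ∃ g : G, g • (a : X) = b
    · obtain ⟨g, hg⟩ := hab
      obtain ⟨n, hn⟩ := L.exists_mem g
      filter_upwards [Filter.eventually_ge_atTop n] with k hk g' hg'
      rw [hf a g' g (hg'.trans hg.symm)]
      exact L.subset hk hn
    · exact Filter.Eventually.of_forall fun n g hg => (hab ⟨g, hg⟩).elim
  have h2 : ∀ᶠ n in Filter.atTop, ∀ a ∈ {d | r c d}, ∀ b ∈ {d | r c d},
      ∀ g : G, g • (a : X) = b → g ∈ L n :=
    hfin.eventually_all.2 fun a ha => hfin.eventually_all.2 (h a ha)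
  filter_upwards [h2] with n hn a b ha hab g hg
  exact hn a ha b (r.trans ha hab) g hg

theorem IsHyperfinite.isHypercompact (hf : IsFreeAction G X)
    (hC : IsLacunaryCocompactCrossSection G C) (hyp : IsHyperfinite (orbitRelOn G C)) :
    IsHypercompact G X := by
  obtain ⟨F, hF⟩ := hyp
  obtain ⟨V, hV, hCV⟩ := hC.lacunary.exists_isSparse
  obtain ⟨K, hK1, hK, hKC⟩ := hC.cocompact
  have hCm := hC.crossSection.borel
  have hcov : ∀ x : X, ∃ g ∈ K⁻¹, g • x ∈ C := by
    intro x
    obtain ⟨k, hk, c, hc, hkc⟩ := (hKC.symm ▸ Set.mem_univ x : x ∈ K • C)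
    exact ⟨k⁻¹, Set.inv_mem_inv.2 hk, by rw [← hkc]; simpa using hc⟩
  obtain ⟨π, hπ, hπK⟩ := exists_measurable_smul_mem hf hCm hV hCV hK.inv.measurableSet hcov
  have L : CompactExhaustion G := CompactExhaustion.choice G
  have hFo : ∀ m, F m ≤ orbitRelOn G C := fun m c d h => (hF.union c d).2 ⟨m, h⟩
  have horb : ∀ c d : C, orbitRelOn G C c d ↔ ∃ g : G, g • (c : X) = d := by
    intro c d
    exact ⟨fun h => (MulAction.orbitRel G X).symm h, fun h => (MulAction.orbitRel G X).symm h⟩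
  let E : ℕ → Setoid X := fun n => (boundedPart (L n) F hF.mono n).comap π
  have hEmono : Monotone E := fun m n hmn x y h =>
    boundedPart_mono hF.mono (L.subset hmn) hmn h
  have hE : ∀ n x y, E n x y ↔ boundedPart (L n) F hF.mono n (π x) (π y) := fun _ _ _ => Iff.rfl
  have hEo : ∀ n, E n ≤ MulAction.orbitRel G X := by
    intro n x y h
    have h' : orbitRelOn G C (π x) (π y) := by
      rcases h with h | ⟨m, -, h, -⟩
      · rw [h]
      · exact hFo m h
    obtain ⟨g, hg⟩ := (horb _ _).1 h'
    obtain ⟨a, -, ha⟩ := hπK x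
    obtain ⟨b, -, hb⟩ := hπK y
    refine (MulAction.orbitRel G X).symm ⟨b⁻¹ * g * a, ?_⟩
    simp only [mul_smul]
    rw [← ha, hg, hb, inv_smul_smul]
  have hequi : ∀ (x : X) (D : Set G), IsCompact D →
      ∀ᶠ n in Filter.atTop, D ⊆ returnSet G (E n) x := by
    intro x D hD
    -- For `g ∈ D` the point `π (g • x)` lies in `(K⁻¹ * D) • x ∩ C`, which is finite; so it
    -- suffices to treat each such point separately.
    have hfin := (hCV.separatedBy hf x).finite_inter hV (hK.inv.mul hD)
    have h1 : ∀ h ∈ {g : G | g • x ∈ C} ∩ (K⁻¹ * D), ∀ᶠ n in Filter.atTop,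
        ∀ d : C, (d : X) = h • x → boundedPart (L n) F hF.mono n (π x) d := by
      rintro h ⟨hh, -⟩
      obtain ⟨a, -, ha⟩ := hπK x
      have : orbitRelOn G C (π x) ⟨h • x, hh⟩ :=
        (horb _ _).2 ⟨h * a⁻¹, by rw [ha]; simp [mul_smul]⟩
      obtain ⟨m, hm⟩ := (hF.union _ _).1 this
      filter_upwards [exists_hasBoundedClass hf L (hF.finite m (π x)),
        Filter.eventually_ge_atTop m] with n hn hmn d hd
      have hd' : d = ⟨h • x, hh⟩ := Subtype.ext hd
      exact Or.inr ⟨m, hmn, hd' ▸ hm, hn⟩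
    filter_upwards [hfin.eventually_all.2 h1] with n hn g hg
    obtain ⟨b, hb, hbg⟩ := hπK (g • x)
    rw [smul_smul] at hbg
    exact hn (b * g) ⟨show (b * g) • x ∈ C from hbg ▸ (π (g • x)).2, Set.mul_mem_mul hb hg⟩ _ hbg
  refine ⟨E, ⟨fun n => ⟨⟨?_, hEo n⟩, ?_⟩, hEmono, fun x y => ⟨?_, ?_⟩⟩, hequi⟩
  · exact (isBorelEquiv_boundedPart hf hCm hV hCV (L.isCompact n).measurableSet hF.mono hF.borel
      hFo n).preimage (hπ.prodMap hπ)
  -- `K⁻¹` and `K` account for moving to `C` and back, `{1}` for the case of equal `π`-values; the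
  -- extra `K` only secures an identity neighbourhood.
  · refine ⟨K ∪ K * ({1} ∪ L n) * K⁻¹, Filter.mem_of_superset hK1 Set.subset_union_left,
      hK.union ((hK.mul (isCompact_singleton.union (L.isCompact n))).mul hK.inv), ?_⟩
    intro x g hg
    right
    obtain ⟨a, ha, hax⟩ := hπK x
    obtain ⟨b, hb, hbx⟩ := hπK (g • x)
    have hl : (b * g * a⁻¹) • (π x : X) = π (g • x) := by
      rw [hax, hbx]; simp [mul_smul]
    have hmem : b * g * a⁻¹ ∈ ({1} ∪ L n : Set G) := by
      rcases boundedPart_eq_or_mem ((hE _ _ _).1 hg) with h | h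
      · left
        rw [← h] at hl
        exact hf _ _ _ (hl.trans (one_smul G _).symm)
      · exact Or.inr (h _ hl)
    have : g = b⁻¹ * (b * g * a⁻¹) * a := by group
    rw [this]
    exact Set.mul_mem_mul (Set.mul_mem_mul hb hmem) ha
  · intro h
    obtain ⟨g, hg⟩ : y ∈ MulAction.orbit G x := (MulAction.orbitRel G X).symm h
    obtain ⟨n, hn⟩ := (hequi x {g} isCompact_singleton).exists
    have : E n x (g • x) := hn rfl
    simp only at hg
    exact ⟨n, hg ▸ this⟩
  · rintro ⟨n, h⟩
    exact hEo n h

end Hypercompact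

theorem mainTheorem1
    {G : Type*} [Group G] [TopologicalSpace G] [IsTopologicalGroup G] [PolishSpace G]
    [LocallyCompactSpace G] [MeasurableSpace G] [BorelSpace G]
    {X : Type*} [MeasurableSpace X] [StandardBorelSpace X] [MulAction G X] [MeasurableSMul₂ G X]
    (hfree : ∀ g : G, g ≠ 1 → ∀ x : X, g • x ≠ x) :
    List.TFAE [
      ∃ E : ℕ → Setoid X, IsCompactFiltration G E,
      IsSectionalHyperfinite G X,
      IsHypercompact G X,
      ∃ C : Set X, IsLacunaryCocompactCrossSection G C ∧ IsHyperfinite (orbitRelOn G C)] := by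
  have hf := isFreeAction_of_smul_ne hfree
  tfae_have 1 → 2 := fun ⟨_, hE⟩ => hE.isSectionalHyperfinite hf
  tfae_have 2 → 4 := fun h => by
    obtain ⟨C, hC⟩ := exists_isLacunaryCocompactCrossSection (G := G) (X := X) hf
    exact ⟨C, hC, h C hC⟩
  tfae_have 4 → 3 := fun ⟨_, hC, hyp⟩ => hyp.isHypercompact hf hC
  tfae_have 3 → 1 := fun ⟨E, hE⟩ => ⟨E, hE.compactFiltration⟩
  tfae_finish
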